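/- Let $k$ be a field of characteristic zero (not necessarily algebraically closed). All rings are commutative; a $\sigma$-ring is a ring with a ring endomorphism $\sigma$, and its ring of constants is $R^\sigma=\{r\in R:\sigma(r)=r\}$. Regard $K=k(z)$ as a $\sigma$-field via $\sigma(h(z))=h(z+1)$. Let $\mathrm{Seq}_k$ be the ring of sequences $\mathbb{N}\to k$ with componentwise operations, two sequences being identified if they agree at all sufficiently large indices, with $\sigma(f(0),f(1),\dots)=(f(1),f(2),\dots)$. It is a $K$-$\sigma$-algebra (a $K$-algebra whose structure map commutes with $\sigma$) via $h\mapsto(h(0),h(1),h(2),\dots)$, the values at the finitely many poles of $h$ being irrelevant. Let $A\in\mathrm{GL}_n(K)$. A Picard–Vessiot ring for $\sigma(y)=Ay$ is a $K$-$\sigma$-algebra $R$ such that (i) there is $Y\in\mathrm{GL}_n(R)$ with $\sigma(Y)=AY$ and $R=K[Y_{ij},1/\det Y]$; (ii) $R$ is $\sigma$-simple, i.e. $R\neq 0$ and the only ideals $I$ of $R$ with $\sigma(I)\subseteq I$ are $0$ and $R$. A $\sigma$-pseudo field is a $\sigma$-ring $L$ for which there are an integer $l\ge 1$ and orthogonal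 idempotents $e_0,\dots,e_{l-1}\in L$ with $L=e_0L\oplus\dots\oplus e_{l-1}L$, $\sigma(e_0)=e_1,\dots,\sigma(e_{l-2})=e_{l-1},\ \sigma(e_{l-1})=e_0$, and every $e_iL$ a field. A Picard–Vessiot extension for $\sigma(y)=Ay$ is a $K$-$\sigma$-algebra $L$ that is a $\sigma$-pseudo field such that (i) there is $Y\in\mathrm{GL}_n(L)$ with $\sigma(Y)=AY$ such that $L$ is the total ring of fractions of $K[Y_{ij}]$; (ii) $L^\sigma=K^\sigma$. Proposition. There exists a $K$-subalgebra $R$ of $\mathrm{Seq}_k$ with $\sigma(R)\subseteq R$ that, with the restriction of $\sigma$, is a Picard–Vessiot ring for $\sigma(y)=Ay$. Moreover, there exists a Picard–Vessiot extension for $\sigma(y)=Ay$. -/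

import Mathlib

universe u

namespace PicardVessiot

open Filter

/-! ### Difference rings and Picard-Vessiot theory

A difference ring is a commutative ring `R` together with a ring endomorphism `σ : R →+* R`. -/

/-- The ring of constants of a difference ring. -/
def constants {R : Type*} [CommRing R] (σ : R →+* R) : Subring R :=
  σ.eqLocus (RingHom.id R)

/-- A difference ring is `σ`-simple if it is non-zero and its only `σ`-ideals, i.e. ideals `I` with
`σ(I) ⊆ I`, are the trivial ones. -/
def IsSigmaSimple {R : Type*} [CommRing R] (σ : R →+* R) : Prop :=
  Nontrivial R ∧ ∀ I : Ideal R, (∀ x ∈ I, σ x ∈ I) → I = ⊥ ∨ I = ⊤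

/-- A `σ`-pseudo field: there are an integer `l ≥ 1` and orthogonal idempotents `e₀, …, e_{l-1}`
with `L = e₀L ⊕ ⋯ ⊕ e_{l-1}L`, which are permuted cyclically by `σ` (addition in `Fin l` is modulo
`l`) and for which every ring `eᵢL` is a field. -/
def IsSigmaPseudoField {L : Type*} [CommRing L] (σ : L →+* L) : Prop :=
  ∃ (l : ℕ) (_ : NeZero l) (e : Fin l → L) (he : CompleteOrthogonalIdempotents e),
    (∀ i, σ (e i) = e (i + 1)) ∧ ∀ i, IsField (he.idem i).Corner

/-- The `K`-algebra `R` with the endomorphism `σR` is a difference algebra over `(K, σK)`. -/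
def IsDifferenceAlgebra {K R : Type*} [Field K] [CommRing R] [Algebra K R]
    (σK : K →+* K) (σR : R →+* R) : Prop :=
  ∀ a : K, σR (algebraMap K R a) = algebraMap K R (σK a)

/-- `Y ∈ GLₙ(R)` is a fundamental solution matrix for `σ(y) = Ay`, i.e. `σ(Y) = AY`. -/
def IsFundamentalMatrix {K R : Type*} [Field K] [CommRing R] [Algebra K R] (σR : R →+* R)
    {n : ℕ} (A : Matrix.GeneralLinearGroup (Fin n) K)
    (Y : Matrix.GeneralLinearGroup (Fin n) R) : Prop :=
  Matrix.GeneralLinearGroup.map σR Y =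
    Matrix.GeneralLinearGroup.map (algebraMap K R) A * Y

/-- The set of entries of an invertible matrix. -/
def entries {R : Type*} [CommRing R] {n : ℕ}
    (Y : Matrix.GeneralLinearGroup (Fin n) R) : Set R :=
  Set.range fun p : Fin n × Fin n => Y.val p.1 p.2

/-- `R` is a Picard-Vessiot ring for `σ(y) = Ay`: a difference algebra over `(K, σK)` of the form
`K[Yᵢⱼ, 1 / det Y]`, with `Y` a fundamental solution matrix, which is `σ`-simple. -/
structure IsPicardVessiotRing {K R : Type*} [Field K] [CommRing R] [Algebra K R]
    (σK : K →+* K) (σR : R →+* R) {n : ℕ} (A : Matrix.GeneralLinearGroup (Fin n) K) : Prop where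
  isDifferenceAlgebra : IsDifferenceAlgebra σK σR
  generated : ∃ Y : Matrix.GeneralLinearGroup (Fin n) R, IsFundamentalMatrix σR A Y ∧
    Algebra.adjoin K (entries Y ∪ {((Matrix.GeneralLinearGroup.det Y)⁻¹ : Rˣ).val}) = ⊤
  simple : IsSigmaSimple σR

/-- `L` is a Picard-Vessiot extension for `σ(y) = Ay`: a `σ`-pseudo field extension of `(K, σK)`
which is the total ring of fractions of `K[Yᵢⱼ]`, with `Y` a fundamental solution matrix, and whose
constants are those of `K`. -/
structure IsPicardVessiotExtension {K L : Type*} [Field K] [CommRing L] [Algebra K L]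
    (σK : K →+* K) (σL : L →+* L) {n : ℕ} (A : Matrix.GeneralLinearGroup (Fin n) K) : Prop where
  isDifferenceAlgebra : IsDifferenceAlgebra σK σL
  pseudoField : IsSigmaPseudoField σL
  generated : ∃ Y : Matrix.GeneralLinearGroup (Fin n) L, IsFundamentalMatrix σL A Y ∧
    IsFractionRing (Algebra.adjoin K (entries Y)) L
  constants_eq : constants σL = (constants σK).map (algebraMap K L)

/-! ### The difference field `k(z)` -/

/-- The endomorphism `h(z) ↦ h(z + 1)` of `k(z)`. -/
noncomputable def ratShift (k : Type*) [Field k] : RatFunc k →+* RatFunc k :=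
  RatFunc.mapRingHom (Polynomial.taylorAlgHom (1 : k))
    (nonZeroDivisors_le_comap_nonZeroDivisors_of_injective _ (Polynomial.taylor_injective 1))

/-! ### The difference ring of sequences -/

/-- The ring of sequences `ℕ → k`, two sequences being identified if they agree at all large
indices. -/
abbrev Seq (k : Type*) : Type _ := Germ (atTop : Filter ℕ) k

/-- The shift `(f(0), f(1), …) ↦ (f(1), f(2), …)` on the ring of sequences. -/
def seqShift (k : Type*) [Field k] : Seq k →+* Seq k where
  toFun f := f.compTendsto (fun i : ℕ => i + 1) (tendsto_add_atTop_nat 1)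
  map_zero' := rfl
  map_one' := rfl
  map_add' f g := by
    induction f using Germ.inductionOn
    induction g using Germ.inductionOn
    rfl
  map_mul' f g := by
    induction f using Germ.inductionOn
    induction g using Germ.inductionOn
    rfl

theorem eventually_eval_ne_zero {k : Type*} [Field k] [CharZero k] {p : Polynomial k}
    (hp : p ≠ 0) : ∀ᶠ i : ℕ in atTop, p.eval₂ (RingHom.id k) (i : k) ≠ 0 := by
  rw [← Nat.cofinite_eq_atTop]
  refine ((Polynomial.finite_setOfPred_isRoot hp).preimage
    (Nat.cast_injective (R := k)).injOn).subset fun i hi => ?_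
  simpa [hp, Polynomial.eval₂_id] using hi

/-- The embedding `h ↦ (h(0), h(1), h(2), …)` of `k(z)` into the ring of sequences. The values at
the finitely many poles of `h` do not matter. -/
noncomputable def ratToSeq (k : Type*) [Field k] [CharZero k] : RatFunc k →+* Seq k where
  toFun h := ((fun i : ℕ => h.eval (RingHom.id k) (i : k)) : ℕ → k)
  map_zero' := by simp only [RatFunc.eval_zero]; rfl
  map_one' := by simp only [RatFunc.eval_one]; rfl
  map_add' f g := by
    refine Germ.coe_eq.2 ?_
    filter_upwards [eventually_eval_ne_zero f.denom_ne_zero,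
      eventually_eval_ne_zero g.denom_ne_zero] with i hf hg
    exact RatFunc.eval_add _ _ hf hg
  map_mul' f g := by
    refine Germ.coe_eq.2 ?_
    filter_upwards [eventually_eval_ne_zero f.denom_ne_zero,
      eventually_eval_ne_zero g.denom_ne_zero] with i hf hg
    exact RatFunc.eval_mul _ _ hf hg

/-- The ring of sequences as a `k(z)`-algebra. -/
noncomputable instance seqAlgebra (k : Type*) [Field k] [CharZero k] :
    Algebra (RatFunc k) (Seq k) :=
  (ratToSeq k).toAlgebra

end PicardVessiot

-- Solutions exist by iteration. Clear denominators, D·A = M with D and M polynomial, and put Y(i+1)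
-- = D(i)⁻¹M(i)Y(i) for large i. This gives an invertible matrix Z over `Seq k`, and R = k(z)[Z,
-- 1/det Z] is stable under the shift. The point is that R is σ-simple although k need not be
-- algebraically closed.
--
-- Let 𝔭 be the ideal of polynomials over k in z and the matrix entries that vanish at (i, Y(i)) for
-- all large i. A proper σ-ideal of R pulls back to an ideal I ⊇ 𝔭 that is stable under the shift up
-- to powers of D and contains no q(z)·det^m with q ≠ 0. The core, `seqEval_eq_zero_of_mem`, is that
-- then I = 𝔭. By Chevalley's theorem and the Nullstellensatz (`exists_forall_exists_algHom`), for a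
-- large integer N the ideal I has a zero (N, y) with y invertible over the algebraic closure F.
-- Write y = Y(N)g; shift stability propagates this zero to (i, Y(i)g) for all i ≥ N. The relations
-- 𝔭_F of Y over F are spanned by 𝔭 ⊆ I, so they also vanish along Yg: 𝔭_F lies in its preimage
-- under right multiplication by g. That map is surjective on a Noetherian ring, so the two are
-- equal (`comap_le_of_le_comap`). Elements of I lie in the preimage, hence in 𝔭.
--
-- The extension is the total ring of fractions of R. It is reduced and Noetherian, so a maximal
-- ideal is the annihilator of one element, which yields an idempotent with a field as corner
-- (`exists_primitive_idempotent`); the σ-orbit of this idempotent splits the ring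
-- (`IsSigmaSimple.isSigmaPseudoField`). No constants are added, because the denominators of a
-- constant fraction form a σ-ideal (`IsSigmaSimple.constants_fractionRing`).

universe v

namespace PicardVessiot

open Filter
open scoped nonZeroDivisors

/-! ### σ-simple rings and pseudo fields -/

section TotalRingOfFractions

variable {L : Type*} [CommRing L]

/-- In a `σ`-simple ring a `σ`-ideal with a non-zero element is the whole ring. -/
theorem IsSigmaSimple.eq_top_of_mem_of_ne_zero {σ : L →+* L} (h : IsSigmaSimple σ) {I : Ideal L}
    (hI : ∀ x ∈ I, σ x ∈ I) {x : L} (hx : x ∈ I) (hx0 : x ≠ 0) : I = ⊤ :=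
  (h.2 I hI).resolve_left fun hb => hx0 (by simpa [hb] using hx)

theorem IsSigmaSimple.injective {σ : L →+* L} (h : IsSigmaSimple σ) : Function.Injective σ := by
  have := h.1
  rw [injective_iff_map_eq_zero]
  intro x hx
  by_contra hx0
  have := h.eq_top_of_mem_of_ne_zero (I := RingHom.ker σ)
    (fun y hy => by simp [RingHom.mem_ker.1 hy]) (RingHom.mem_ker.2 hx) hx0
  exact RingHom.ker_ne_top σ this

theorem IsSigmaSimple.isReduced {σ : L →+* L} (h : IsSigmaSimple σ) : IsReduced L := by
  have := h.1
  refine ⟨fun x hx => ?_⟩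
  by_contra hx0
  have := h.eq_top_of_mem_of_ne_zero (I := nilradical L)
    (fun y hy => by
      rw [mem_nilradical] at hy ⊢
      exact hy.map σ) (mem_nilradical.2 hx) hx0
  have h1 : (1 : L) ∈ nilradical L := this ▸ Submodule.mem_top
  exact not_isNilpotent_one (mem_nilradical.1 h1)

/-- In a reduced Noetherian total ring of fractions there is an idempotent whose corner is a
field. -/
theorem exists_primitive_idempotent [IsNoetherianRing L] [IsReduced L] [Nontrivial L]
    [IsFractionRing L L] :
    ∃ e : L, IsIdempotentElem e ∧ e ≠ 0 ∧ ∀ x, x * e ≠ 0 → ∃ y, x * e * y = e := by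
  obtain ⟨m, hm⟩ := Ideal.exists_maximal L
  -- In a Noetherian total ring of fractions a maximal ideal consists of zero divisors, so it is the
  -- annihilator of a single element `a`.
  have hass := hm.mem_associatedPrimes_of_isFractionRing
  rw [AssociatedPrimes.mem_iff, isAssociatedPrime_iff] at hass
  obtain ⟨-, a, ha⟩ := hass
  have hma : ∀ x, x ∈ m ↔ x * a = 0 := fun x => by
    rw [ha, Submodule.mem_colon_singleton]; simp
  have ham : a ∉ m := fun h => by
    have h0 : a = 0 := by
      have := (hma a).1 h
      exact pow_eq_zero_iff two_ne_zero |>.1 (by rw [pow_two, this])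
    exact hm.ne_top (Ideal.eq_top_iff_one _ |>.2 ((hma 1).2 (by simp [h0])))
  have key : ∀ x, x ∉ m → ∃ b, (1 - x * b) * a = 0 := fun x hx => by
    obtain ⟨b, hb⟩ := hm.exists_inv hx
    obtain ⟨i, hi, h1⟩ := hb
    refine ⟨b, (hma _).1 ?_⟩
    have : 1 - x * b = i := by rw [← h1]; ring
    rwa [this]
  obtain ⟨b, hb⟩ := key a ham
  -- Reducedness puts `a` outside `m`, so `b` inverts `a` modulo `m`; a congruence modulo `m`
  -- becomes an equality after multiplication by `a`.
  refine ⟨a * b, ?_, ?_, fun x hx => ?_⟩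
  · show a * b * (a * b) = a * b
    linear_combination (-b) * hb
  · intro h
    rw [h] at hb
    have : a = 0 := by simpa using hb
    exact ham (by simp [this])
  · have hxm : x ∉ m := fun h => hx (by linear_combination b * (hma x).1 h)
    obtain ⟨c, hc⟩ := key x hxm
    exact ⟨c, by linear_combination (-b) * hc⟩

theorem isField_corner {e : L} (he : IsIdempotentElem e) (h0 : e ≠ 0)
    (h : ∀ x, x * e ≠ 0 → ∃ y, x * e * y = e) : IsField he.Corner where
  exists_pair_ne := ⟨0, 1, fun h' => h0 (congrArg Subtype.val h').symm⟩
  mul_comm := mul_comm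
  mul_inv_cancel := by
    rintro ⟨a, x, rfl⟩ ha
    have hx : e * x * e = x * e := by
      have := he.eq
      linear_combination x * this
    obtain ⟨y, hy⟩ := h x (fun h' => ha (Subtype.ext (hx.trans h')))
    refine ⟨⟨e * y * e, y, rfl⟩, Subtype.ext ?_⟩
    show e * x * e * (e * y * e) = e
    have := he.eq
    rw [hx]
    linear_combination hy * e * e + (e + 1) * this

/-- A `σ`-simple ring with `σ` surjective containing an idempotent whose corner is a field is a
pseudo field: the idempotents are the `σ`-orbit of the given one. -/
theorem IsSigmaSimple.isSigmaPseudoField {σ : L →+* L} (h : IsSigmaSimple σ)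
    (hsurj : Function.Surjective σ) {e : L} (he : IsIdempotentElem e) (h0 : e ≠ 0)
    (hf : ∀ x, x * e ≠ 0 → ∃ y, x * e * y = e) : IsSigmaPseudoField σ := by
  have hinj := h.injective
  set E : ℕ → L := fun i => σ^[i] e with hE
  have hEs : ∀ i, σ (E i) = E (i + 1) := fun i => (Function.iterate_succ_apply' σ i e).symm
  have hid : ∀ i, IsIdempotentElem (E i) := by
    intro i
    induction i with
    | zero => exact he
    | succ i ih => rw [← hEs]; exact ih.map σ
  have hne : ∀ i, E i ≠ 0 := by
    intro i
    induction i with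
    | zero => exact h0
    | succ i ih => rw [← hEs]; exact fun h' => ih (hinj (by simpa using h'))
  have hfi : ∀ i x, x * E i ≠ 0 → ∃ y, x * E i * y = E i := by
    intro i
    induction i with
    | zero => exact hf
    | succ i ih =>
      intro x hx
      obtain ⟨x, rfl⟩ := hsurj x
      rw [← hEs] at hx ⊢
      rw [← map_mul] at hx
      obtain ⟨y, hy⟩ := ih x (fun h' => hx (by rw [h', map_zero]))
      exact ⟨σ y, by rw [← map_mul, ← map_mul, hy]⟩
  -- Each corner is a field, so two members of the orbit with non-zero product are multiples of each
  -- other, and idempotents with this property coincide.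
  have heq : ∀ i j, E i * E j ≠ 0 → E i = E j := by
    intro i j hij
    obtain ⟨y, hy⟩ := hfi j (E i) hij
    obtain ⟨z, hz⟩ := hfi i (E j) (by rwa [mul_comm])
    have hi := (hid i).eq
    have hj := (hid j).eq
    have h1 : E i * E j = E j := by
      rw [← hy]; linear_combination (E j * y) * hi
    have h2 : E j * E i = E i := by
      rw [← hz]; linear_combination (E i * z) * hj
    exact h2.symm.trans ((mul_comm _ _).trans h1)
  have htop : Ideal.span (Set.range E) = ⊤ := by
    refine h.eq_top_of_mem_of_ne_zero (fun x hx => ?_) (Ideal.subset_span ⟨0, rfl⟩) h0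
    have : (Ideal.span (Set.range E)) ≤ (Ideal.span (Set.range E)).comap σ := by
      rw [Ideal.span_le]
      rintro _ ⟨i, rfl⟩
      exact Ideal.subset_span ⟨i + 1, (hEs i).symm⟩
    exact this hx
  -- Without a return to `e` the whole orbit is orthogonal. But 1 is a combination of finitely many
  -- `E i`, so a later member would be killed by 1.
  have hper : ∃ i, 0 < i ∧ E i = e := by
    by_contra! hcon
    have hdis : ∀ i j, i < j → E i * E j = 0 := by
      intro i j hij
      by_contra hne'
      have := heq i j hne'
      obtain ⟨d, rfl⟩ := Nat.exists_eq_add_of_lt hij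
      refine hcon (d + 1) (by omega) ?_
      apply (hinj.iterate i)
      rw [show i + d + 1 = i + (d + 1) by ring] at this
      simp only [hE, Function.iterate_add_apply] at this ⊢
      exact this.symm
    have h1 : (1 : L) ∈ Ideal.span (Set.range E) := htop ▸ Submodule.mem_top
    obtain ⟨c, hc⟩ := (Finsupp.mem_ideal_span_range_iff_exists_finsupp).1 h1
    obtain ⟨m, hm⟩ := c.support.bddAbove
    have : E (m + 1) = 0 := by
      rw [← one_mul (E (m + 1)), ← hc, Finsupp.sum, Finset.sum_mul]
      refine Finset.sum_eq_zero fun i hi => ?_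
      have : i ≤ m := hm hi
      rw [mul_assoc, hdis i (m + 1) (by omega), mul_zero]
    exact hne _ this
  classical
  let l := Nat.find hper
  have hl0 : 0 < l := (Nat.find_spec hper).1
  have hEl : E l = e := (Nat.find_spec hper).2
  have hmin : ∀ i, 0 < i → i < l → E i ≠ e := fun i hi hil h' => Nat.find_min hper hil ⟨hi, h'⟩
  have : NeZero l := ⟨hl0.ne'⟩
  have hort : ∀ i j, i < j → j < l → E i * E j = 0 := by
    intro i j hij hjl
    by_contra hne'
    have := heq i j hne'
    obtain ⟨d, rfl⟩ := Nat.exists_eq_add_of_lt hij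
    refine hmin (d + 1) (by omega) (by omega) ?_
    apply (hinj.iterate i)
    rw [show i + d + 1 = i + (d + 1) by ring] at this
    simp only [hE, Function.iterate_add_apply] at this ⊢
    exact this.symm
  have hshift : ∀ i : Fin l, σ (E i) = E ((i + 1 : Fin l) : ℕ) := by
    intro i
    rw [hEs, Fin.val_add, Fin.val_one', Nat.add_mod_mod]
    rcases Nat.lt_or_ge (i + 1) l with h' | h'
    · rw [Nat.mod_eq_of_lt h']
    · have : (i : ℕ) + 1 = l := le_antisymm i.2 h'
      rw [this, Nat.mod_self, hEl]
      rfl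
  have hOI : OrthogonalIdempotents (fun i : Fin l => E i) := by
    refine ⟨fun i => hid i, fun i j hij => ?_⟩
    rcases lt_or_gt_of_ne hij with h' | h'
    · exact hort _ _ h' j.2
    · show E i * E j = 0
      rw [mul_comm]; exact hort _ _ h' i.2
  have hsum : σ (∑ i : Fin l, E i) = ∑ i : Fin l, E i := by
    rw [map_sum]
    simp_rw [hshift]
    exact Equiv.sum_comp (Equiv.addRight (1 : Fin l)) (fun i : Fin l => E i)
  have hsid := hOI.isIdempotentElem_sum (s := Finset.univ)
  have hmem0 : (∑ i : Fin l, E i) * e = e := by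
    have := hOI.mul_sum_of_mem (Finset.mem_univ (0 : Fin l))
    rw [mul_comm]; exact this
  -- The sum over one period is fixed by σ, so it generates a non-zero σ-ideal; it is therefore a
  -- unit, and an idempotent unit is 1.
  have hs1 : (∑ i : Fin l, E i) = 1 := by
    have := h.eq_top_of_mem_of_ne_zero (I := Ideal.span {∑ i : Fin l, E i})
      (fun x hx => by
        obtain ⟨y, rfl⟩ := Ideal.mem_span_singleton'.1 hx
        rw [map_mul, hsum]
        exact Ideal.mul_mem_left _ _ (Ideal.mem_span_singleton_self _))
      (Ideal.mem_span_singleton_self _) (fun h' => h0 (by rw [← hmem0, h', zero_mul]))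
    exact (IsIdempotentElem.iff_eq_one_of_isUnit (Ideal.span_singleton_eq_top.1 this)).1 hsid
  exact ⟨l, inferInstance, fun i => E i, ⟨hOI, hs1⟩, hshift,
    fun i => isField_corner _ (hne i) (hfi i)⟩

end TotalRingOfFractions

/-! ### Picard–Vessiot rings and σ on their fractions -/

section PicardVessiotRing

variable {K : Type v} {R : Type u} [Field K] [CommRing R] [Algebra K R]
  {σK : K →+* K} {σR : R →+* R} {n : ℕ} {A : Matrix.GeneralLinearGroup (Fin n) K}

theorem IsFundamentalMatrix.apply {Y : Matrix.GeneralLinearGroup (Fin n) R}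
    (hY : IsFundamentalMatrix σR A Y) (i j : Fin n) :
    σR (Y.val i j) = ∑ l, algebraMap K R (A.val i l) * Y.val l j := by
  have := congrArg (fun M : Matrix.GeneralLinearGroup (Fin n) R => M.val i j) hY
  simpa [Matrix.mul_apply] using this

theorem IsFundamentalMatrix.apply_inv {Y : Matrix.GeneralLinearGroup (Fin n) R}
    (hY : IsFundamentalMatrix σR A Y) (i j : Fin n) :
    Y.val i j = ∑ l, algebraMap K R (A⁻¹.val i l) * σR (Y.val l j) := by
  have h : Y = Matrix.GeneralLinearGroup.map (algebraMap K R) A⁻¹ *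
      Matrix.GeneralLinearGroup.map σR Y := by
    rw [hY, ← mul_assoc, ← map_mul, inv_mul_cancel, map_one, one_mul]
  have := congrArg (fun M : Matrix.GeneralLinearGroup (Fin n) R => M.val i j) h
  simpa only [Units.val_mul, Matrix.mul_apply, Matrix.GeneralLinearGroup.map_apply] using this

theorem IsFundamentalMatrix.map_det {Y : Matrix.GeneralLinearGroup (Fin n) R}
    (hY : IsFundamentalMatrix σR A Y) :
    Units.map σR.toMonoidHom (Matrix.GeneralLinearGroup.det Y) =
      Units.map (algebraMap K R).toMonoidHom (Matrix.GeneralLinearGroup.det A) *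
        Matrix.GeneralLinearGroup.det Y := by
  have h := congrArg Matrix.GeneralLinearGroup.det hY
  rw [map_mul, Matrix.GeneralLinearGroup.map_det, Matrix.GeneralLinearGroup.map_det] at h
  exact h

theorem IsFundamentalMatrix.map_det_inv {Y : Matrix.GeneralLinearGroup (Fin n) R}
    (hY : IsFundamentalMatrix σR A Y) :
    σR ((Matrix.GeneralLinearGroup.det Y)⁻¹ : Rˣ).val =
      algebraMap K R ((Matrix.GeneralLinearGroup.det A)⁻¹ : Kˣ).val *
        ((Matrix.GeneralLinearGroup.det Y)⁻¹ : Rˣ).val := by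
  have h := congrArg (fun u : Rˣ => (u⁻¹).val) hY.map_det
  simpa [mul_comm, ← map_inv] using h

theorem IsFundamentalMatrix.det_inv_eq {Y : Matrix.GeneralLinearGroup (Fin n) R}
    (hY : IsFundamentalMatrix σR A Y) :
    ((Matrix.GeneralLinearGroup.det Y)⁻¹ : Rˣ).val =
      algebraMap K R (Matrix.GeneralLinearGroup.det A).val *
        σR ((Matrix.GeneralLinearGroup.det Y)⁻¹ : Rˣ).val := by
  rw [hY.map_det_inv, ← mul_assoc, ← map_mul, Units.mul_inv, map_one, one_mul]

/-- The image of σ is a K-subalgebra because `σK` is onto, and it contains the generators because Y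
= A⁻¹σ(Y) and 1/det Y = det A · σ(1/det Y). -/
theorem IsPicardVessiotRing.surjective (h : IsPicardVessiotRing σK σR A)
    (hK : Function.Surjective σK) : Function.Surjective σR := by
  obtain ⟨Y, hY, hadj⟩ := h.generated
  let S : Subalgebra K R := { σR.range with
    algebraMap_mem' := fun a => by
      obtain ⟨b, rfl⟩ := hK a
      exact ⟨algebraMap K R b, h.isDifferenceAlgebra b⟩ }
  have hS : ∀ x, σR x ∈ S := fun x => ⟨x, rfl⟩
  have : Algebra.adjoin K (entries Y ∪ {((Matrix.GeneralLinearGroup.det Y)⁻¹ : Rˣ).val}) ≤ S := by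
    rw [Algebra.adjoin_le_iff]
    rintro _ (⟨⟨i, j⟩, rfl⟩ | rfl)
    · simp only [SetLike.mem_coe]
      rw [hY.apply_inv]
      exact sum_mem fun l _ => mul_mem (S.algebraMap_mem _) (hS _)
    · rw [hY.det_inv_eq]
      exact mul_mem (S.algebraMap_mem _) (hS _)
  rw [hadj] at this
  exact fun x => this (Algebra.mem_top (x := x))

theorem IsPicardVessiotRing.isNoetherianRing (h : IsPicardVessiotRing σK σR A) :
    IsNoetherianRing R := by
  obtain ⟨Y, hY, hadj⟩ := h.generated
  have : Algebra.FiniteType K R := by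
    refine ⟨Subalgebra.fg_def.2 ⟨_, ?_, hadj⟩⟩
    exact (Set.finite_range _).union (Set.finite_singleton _)
  exact Algebra.FiniteType.isNoetherianRing K R

/-- The extension of an automorphism to the total ring of fractions. -/
noncomputable def fractionRingMap (σ : R →+* R) (hσ : Function.Bijective σ) :
    FractionRing R →+* FractionRing R :=
  IsLocalization.map (M := R⁰) (T := R⁰) (FractionRing R) σ
    (fun x hx => by
      rw [Submonoid.mem_comap, mem_nonZeroDivisors_iff_right]
      intro y hy
      obtain ⟨y, rfl⟩ := hσ.2 y
      rw [← map_mul] at hy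
      rw [(mem_nonZeroDivisors_iff_right.1 hx) y (hσ.1 (by rw [hy, map_zero])), map_zero])

theorem fractionRingMap_algebraMap {σ : R →+* R} (hσ : Function.Bijective σ) (x : R) :
    fractionRingMap σ hσ (algebraMap R _ x) = algebraMap R _ (σ x) :=
  IsLocalization.map_eq _ _

theorem fractionRingMap_surjective {σ : R →+* R} (hσ : Function.Bijective σ) :
    Function.Surjective (fractionRingMap σ hσ) := by
  intro z
  obtain ⟨⟨r, t⟩, hz⟩ := IsLocalization.surj R⁰ z
  obtain ⟨r, rfl⟩ := hσ.2 r
  obtain ⟨t, ht⟩ := t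
  obtain ⟨t, rfl⟩ := hσ.2 t
  have ht' : t ∈ R⁰ := by
    rw [mem_nonZeroDivisors_iff_right] at ht ⊢
    intro y hy
    exact hσ.1 (by rw [map_zero]; exact ht _ (by rw [← map_mul, hy, map_zero]))
  refine ⟨IsLocalization.mk' _ r ⟨t, ht'⟩, ?_⟩
  apply (IsLocalization.map_units (FractionRing R) (⟨σ t, ht⟩ : R⁰)).mul_right_cancel
  rw [hz]
  dsimp only
  rw [← fractionRingMap_algebraMap hσ, ← fractionRingMap_algebraMap hσ, ← map_mul]
  congr 1
  exact IsLocalization.mk'_spec (FractionRing R) r ⟨t, ht'⟩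

/-- An ideal of a localization is extended from its contraction, and the contraction of a σ-ideal is
a σ-ideal. -/
theorem IsSigmaSimple.fractionRing {σ : R →+* R} (h : IsSigmaSimple σ)
    (hσ : Function.Bijective σ) : IsSigmaSimple (fractionRingMap σ hσ) := by
  have := h.1
  refine ⟨inferInstance, fun I hI => ?_⟩
  have hmap := IsLocalization.map_under R⁰ (FractionRing R) I
  rcases h.2 (I.under R) (fun x hx => by
    rw [Ideal.mem_comap] at hx ⊢
    rw [← fractionRingMap_algebraMap hσ]
    exact hI _ hx) with h' | h'
  · left; rw [← hmap, h', Ideal.map_bot]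
  · right; rw [← hmap, h', Ideal.map_top]

/-- The constants of the total ring of fractions of a `σ`-simple ring are those of the ring. -/
theorem IsSigmaSimple.constants_fractionRing {σ : R →+* R} (h : IsSigmaSimple σ)
    (hσ : Function.Bijective σ) :
    constants (fractionRingMap σ hσ) =
      (constants σ).map (algebraMap R (FractionRing R)) := by
  have := h.1
  ext f
  constructor
  · intro hf
    have hf : fractionRingMap σ hσ f = f := hf
    -- The ideal of denominators of `f`. It is a σ-ideal because `f` is constant, and it contains a
    -- regular element, so it contains 1 and `f` lies in `R`.
    let I : Ideal R :=
      { carrier := {r | ∃ s, algebraMap R _ r * f = algebraMap R _ s}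
        zero_mem' := ⟨0, by simp⟩
        add_mem' := by
          rintro a b ⟨s, hs⟩ ⟨t, ht⟩
          exact ⟨s + t, by rw [map_add, add_mul, hs, ht, map_add]⟩
        smul_mem' := by
          rintro c a ⟨s, hs⟩
          exact ⟨c * s, by rw [smul_eq_mul, map_mul, mul_assoc, hs, map_mul]⟩ }
    obtain ⟨⟨r, t⟩, hz⟩ := IsLocalization.surj R⁰ f
    have htop : I = ⊤ := h.eq_top_of_mem_of_ne_zero (x := t.1)
      (by
        rintro x ⟨s, hs⟩
        refine ⟨σ s, ?_⟩
        rw [← fractionRingMap_algebraMap hσ, ← fractionRingMap_algebraMap hσ, ← hs, map_mul, hf])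
      ⟨r, by rw [mul_comm]; exact hz⟩ (nonZeroDivisors.ne_zero t.2)
    obtain ⟨s, hs⟩ : (1 : R) ∈ I := htop ▸ Submodule.mem_top
    rw [map_one, one_mul] at hs
    refine ⟨s, ?_, hs.symm⟩
    apply IsFractionRing.injective R (FractionRing R)
    rw [hs, fractionRingMap_algebraMap] at hf
    exact hf
  · rintro ⟨s, hs, rfl⟩
    have hs : σ s = s := hs
    show fractionRingMap σ hσ _ = _
    rw [fractionRingMap_algebraMap]
    exact congrArg _ hs

end PicardVessiotRing

/-! ### From the Picard–Vessiot ring to the extension -/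

section PicardVessiotExtension

variable {K : Type v} {R : Type u} [Field K] [CommRing R] [Algebra K R]
  {σK : K →+* K} {σR : R →+* R} {n : ℕ} {A : Matrix.GeneralLinearGroup (Fin n) K}

theorem IsFundamentalMatrix.map {L : Type*} [CommRing L] [Algebra K L] (f : R →ₐ[K] L)
    {σL : L →+* L} (hf : ∀ x, σL (f x) = f (σR x)) {Y : Matrix.GeneralLinearGroup (Fin n) R}
    (hY : IsFundamentalMatrix σR A Y) :
    IsFundamentalMatrix σL A (Matrix.GeneralLinearGroup.map f.toRingHom Y) := by
  ext i j
  simp only [Matrix.GeneralLinearGroup.map_apply, Units.val_mul, Matrix.mul_apply]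
  change σL (f (Y.val i j)) = ∑ l, algebraMap K L (A.val i l) * f (Y.val l j)
  rw [hf, hY.apply, map_sum]
  simp [map_mul]

/-- The ring `K[Yᵢⱼ]` has the same total ring of fractions as `K[Yᵢⱼ, 1 / det Y]`. -/
theorem isFractionRing_adjoin_entries (Y : Matrix.GeneralLinearGroup (Fin n) R)
    (hadj : Algebra.adjoin K
      (entries Y ∪ {((Matrix.GeneralLinearGroup.det Y)⁻¹ : Rˣ).val}) = ⊤) :
    IsFractionRing (Algebra.adjoin K (entries
      (Matrix.GeneralLinearGroup.map (algebraMap R (FractionRing R)) Y))) (FractionRing R) := by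
  set L := FractionRing R
  set Z := Matrix.GeneralLinearGroup.map (algebraMap R L) Y with hZ
  set S := Algebra.adjoin K (entries Z) with hS
  set u : Rˣ := Matrix.GeneralLinearGroup.det Y with hu
  set d : L := algebraMap R L u.val with hd
  have hdu : IsUnit d := u.isUnit.map _
  have hent : ∀ i j, algebraMap R L (Y.val i j) ∈ S := fun i j =>
    Algebra.subset_adjoin ⟨(i, j), rfl⟩
  have hdS : d ∈ S := by
    have : d = ((algebraMap R L).mapMatrix Y.val).det := (RingHom.map_det _ _)
    rw [this, Matrix.det_apply']
    refine sum_mem fun s _ => mul_mem (intCast_mem S _) (prod_mem fun i _ => ?_)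
    exact hent _ _
  have hclear : ∀ r : R, ∃ m : ℕ, algebraMap R L r * d ^ m ∈ S := by
    intro r
    have hr : r ∈ Algebra.adjoin K (entries Y ∪ {(u⁻¹ : Rˣ).val}) := hadj ▸ Algebra.mem_top
    induction hr using Algebra.adjoin_induction with
    | mem x hx =>
      rcases hx with ⟨⟨i, j⟩, rfl⟩ | rfl
      · exact ⟨0, by simpa using hent i j⟩
      · refine ⟨1, ?_⟩
        rw [pow_one, hd, ← map_mul, Units.inv_mul, map_one]
        exact one_mem _
    | algebraMap a =>
      refine ⟨0, ?_⟩
      rw [pow_zero, mul_one, ← IsScalarTower.algebraMap_apply]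
      exact S.algebraMap_mem a
    | add x y _ _ hx hy =>
      obtain ⟨a, ha⟩ := hx
      obtain ⟨b, hb⟩ := hy
      refine ⟨a + b, ?_⟩
      have : algebraMap R L (x + y) * d ^ (a + b) =
          (algebraMap R L x * d ^ a) * d ^ b + (algebraMap R L y * d ^ b) * d ^ a := by
        rw [map_add]; ring
      rw [this]
      exact add_mem (mul_mem ha (pow_mem hdS _)) (mul_mem hb (pow_mem hdS _))
    | mul x y _ _ hx hy =>
      obtain ⟨a, ha⟩ := hx
      obtain ⟨b, hb⟩ := hy
      refine ⟨a + b, ?_⟩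
      have : algebraMap R L (x * y) * d ^ (a + b) =
          (algebraMap R L x * d ^ a) * (algebraMap R L y * d ^ b) := by
        rw [map_mul]; ring
      rw [this]
      exact mul_mem ha hb
  have hinj : Function.Injective (algebraMap S L) := Subtype.val_injective
  -- Numerators can be moved into `S` by powers of the unit `d`, so an element regular in `S` stays
  -- regular in `L`, where regular elements are units.
  have hnzd : ∀ s : S, s ∈ S⁰ → IsUnit (s : L) := by
    intro s hs
    have : (s : L) ∈ L⁰ := by
      rw [mem_nonZeroDivisors_iff_right]
      intro x hx
      obtain ⟨⟨r, t⟩, hz⟩ := IsLocalization.surj R⁰ x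
      obtain ⟨m, hm⟩ := hclear r
      have h0 : (⟨_, hm⟩ : S) * s = 0 := by
        apply hinj
        show algebraMap R L r * d ^ m * s = 0
        rw [← hz]
        linear_combination (algebraMap R L t * d ^ m) * hx
      have h1 : algebraMap R L r * d ^ m = 0 :=
        congrArg Subtype.val (mem_nonZeroDivisors_iff_right.1 hs _ h0)
      have h2 := ((hdu.pow m).mul_left_eq_zero).1 h1
      rw [h2] at hz
      exact ((IsLocalization.map_units L t).mul_left_eq_zero).1 hz
    exact IsFractionRing.self_iff_nonZeroDivisors_le_isUnit.mp inferInstance this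
  refine ⟨fun s => hnzd s.1 s.2, fun z => ?_, fun {x y} h => ⟨1, by rw [hinj h]⟩⟩
  obtain ⟨⟨r, t⟩, hz⟩ := IsLocalization.surj R⁰ z
  obtain ⟨a, ha⟩ := hclear r
  obtain ⟨b, hb⟩ := hclear t
  have ha' := mul_mem ha (pow_mem hdS b)
  have hb' := mul_mem hb (pow_mem hdS a)
  refine ⟨⟨⟨_, ha'⟩, ⟨⟨_, hb'⟩, ?_⟩⟩, ?_⟩
  · rw [mem_nonZeroDivisors_iff_right]
    intro x hx
    apply hinj
    rw [map_zero]
    have hx : (x : L) * (algebraMap R L t * d ^ b * d ^ a) = 0 := congrArg Subtype.val hx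
    exact ((((IsLocalization.map_units L t).mul (hdu.pow b)).mul (hdu.pow a)).mul_left_eq_zero).1 hx
  · show z * (algebraMap R L t * d ^ b * d ^ a) = algebraMap R L r * d ^ a * d ^ b
    linear_combination (d ^ a * d ^ b) * hz

/-- The total ring of fractions of a Picard-Vessiot ring without new constants is a
Picard-Vessiot extension. -/
theorem IsPicardVessiotRing.fractionRing (h : IsPicardVessiotRing σK σR A)
    (hσ : Function.Bijective σR)
    (hc : constants σR = (constants σK).map (algebraMap K R)) :
    IsPicardVessiotExtension (L := FractionRing R) σK (fractionRingMap σR hσ) A := by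
  have := h.simple.1
  have := h.isNoetherianRing
  have := IsLocalization.isNoetherianRing R⁰ (FractionRing R) inferInstance
  have hs := h.simple.fractionRing hσ
  have := hs.isReduced
  obtain ⟨e, he, he0, hef⟩ := exists_primitive_idempotent (L := FractionRing R)
  obtain ⟨Y, hY, hadj⟩ := h.generated
  refine ⟨fun a => ?_, hs.isSigmaPseudoField (fractionRingMap_surjective hσ) he he0 hef,
    ⟨_, hY.map (IsScalarTower.toAlgHom K R (FractionRing R))
      (fun x => fractionRingMap_algebraMap hσ x), isFractionRing_adjoin_entries Y hadj⟩, ?_⟩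
  · rw [IsScalarTower.algebraMap_apply K R, fractionRingMap_algebraMap, h.isDifferenceAlgebra,
      ← IsScalarTower.algebraMap_apply]
  · rw [h.simple.constants_fractionRing hσ, hc, Subring.map_map, ← IsScalarTower.algebraMap_eq]

end PicardVessiotExtension

/-! ### Algebraic points over almost all values of a transcendental element -/

section AlgebraicPoints

open Polynomial

/-- If `t` is a transcendental element of a finitely generated algebra `B` over a field `k`, all but
finitely many values of `t` are attained at algebraic points of `B`. -/
theorem exists_forall_exists_algHom {k : Type u} {B : Type v} [Field k] [CommRing B] [Algebra k B]
    [Algebra.FiniteType k B] (F : Type*) [Field F] [Algebra k F] [IsAlgClosed F] (t : B)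
    (ht : Function.Injective (aeval (R := k) t)) :
    ∃ f : k[X], f ≠ 0 ∧ ∀ a : k, f.eval a ≠ 0 → ∃ φ : B →ₐ[k] F, φ t = algebraMap k F a := by
  let g : k[X] →+* B := (aeval (R := k) t).toRingHom
  have hg : g.FinitePresentation := by
    apply RingHom.FinitePresentation.of_finiteType.1
    apply RingHom.FiniteType.of_comp_finiteType (f := (C : k →+* k[X]))
    have : g.comp C = algebraMap k B := by ext; simp [g]
    rw [this, RingHom.finiteType_algebraMap]
    infer_instance
  obtain ⟨S, hS⟩ := PrimeSpectrum.exists_constructibleSetData_iff.2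
    (PrimeSpectrum.isConstructible_range_comap hg)
  -- The image of Spec B is constructible by Chevalley. It contains the generic point, since minimal
  -- primes lift along an injective ring map.
  have hbot : (⟨⊥, Ideal.isPrime_bot⟩ : PrimeSpectrum k[X]) ∈
      Set.range (PrimeSpectrum.comap g) := by
    obtain ⟨p, hp, -, heq⟩ := Ideal.exists_comap_eq_of_mem_minimalPrimes g (I := ⊥) ⊥ (by
      have : Ideal.comap g ⊥ = ⊥ := (RingHom.injective_iff_ker_eq_bot g).1 ht
      rw [this]
      simp [IsDomain.minimalPrimes_eq_singleton_bot])
    exact ⟨⟨p, hp⟩, PrimeSpectrum.ext heq⟩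
  rw [← hS, PrimeSpectrum.ConstructibleSetData.toSet, Set.mem_iUnion₂] at hbot
  obtain ⟨D, hD, hbot⟩ := hbot
  -- The closed condition of the piece through the generic point is vacuous, so this piece is the
  -- basic open set where `D.f` does not vanish.
  have hg0 : ∀ i, D.g i = 0 := fun i => hbot.1 ⟨i, rfl⟩
  refine ⟨D.f, fun h => hbot.2 (by simp [h]), fun a ha => ?_⟩
  have hprime : (RingHom.ker (evalRingHom a)).IsPrime := RingHom.ker_isPrime _
  have hmem : (⟨RingHom.ker (evalRingHom a), hprime⟩ : PrimeSpectrum k[X]) ∈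
      Set.range (PrimeSpectrum.comap g) := by
    rw [← hS, PrimeSpectrum.ConstructibleSetData.toSet, Set.mem_iUnion₂]
    refine ⟨D, hD, ?_, ?_⟩
    · rintro _ ⟨i, rfl⟩
      simp [hg0]
    · intro h
      exact ha (by simpa using h)
  obtain ⟨q, hq⟩ := hmem
  have hq' : q.asIdeal.comap g = RingHom.ker (evalRingHom a) := congrArg PrimeSpectrum.asIdeal hq
  have htq : t - algebraMap k B a ∈ q.asIdeal := by
    have : (X - C a : k[X]) ∈ q.asIdeal.comap g := by rw [hq']; simp
    simpa [g] using this
  obtain ⟨m, hm, hqm⟩ := Ideal.exists_le_maximal q.asIdeal q.2.ne_top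
  let _ := Ideal.Quotient.field m
  -- Nullstellensatz: the residue field is finite over `k`, hence embeds in `F`.
  have := finite_of_finite_type_of_isJacobsonRing k (B ⧸ m)
  refine ⟨(IsAlgClosed.lift (R := k) (S := B ⧸ m) (M := F)).comp (Ideal.Quotient.mkₐ k m), ?_⟩
  have : Ideal.Quotient.mk m t = algebraMap k (B ⧸ m) a := by
    rw [IsScalarTower.algebraMap_apply k B (B ⧸ m)]
    exact Ideal.Quotient.eq.2 (hqm htq)
  simp [this]

end AlgebraicPoints

/-- Over a Noetherian ring, an ideal contained in its preimage under a surjective endomorphism is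
equal to it. -/
theorem comap_le_of_le_comap {S : Type*} [CommRing S] [IsNoetherianRing S] {f : S →+* S}
    (hf : Function.Surjective f) {J : Ideal S} (h : J ≤ J.comap f) : J.comap f ≤ J := by
  let c : ℕ →o Ideal S := ⟨fun m => J.comap (f ^ m), monotone_nat_of_le_succ fun m x hx => by
    rw [Ideal.mem_comap] at hx ⊢
    rw [pow_succ']
    exact h hx⟩
  obtain ⟨m, hm⟩ := monotone_stabilizes_iff_noetherian.2 ‹_› c
  -- Writing `x = f^m w` turns `f x ∈ J` into membership of `w` in step `m + 1` of the chain of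
  -- preimages; stability at `m` gives `x ∈ J`.
  intro x hx
  obtain ⟨w, rfl⟩ := (show Function.Surjective (f ^ m) by
    rw [RingHom.coe_pow]; exact hf.iterate m) x
  have hw : w ∈ c (m + 1) := by
    show (f ^ (m + 1)) w ∈ J
    rw [pow_succ']
    exact hx
  rw [← hm (m + 1) (Nat.le_succ m)] at hw
  exact hw

/-! ### Polynomials in z and the entries of a matrix -/

section Points

variable {n : ℕ}

/-- The point of affine space with first coordinate `z` and the entries of the matrix `y` as the
others. -/
def point {F : Type*} (z : F) (y : Matrix (Fin n) (Fin n) F) : Option (Fin n × Fin n) → F :=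
  fun o => o.elim z fun p => y p.1 p.2

@[simp] theorem point_none {F : Type*} (z : F) (y : Matrix (Fin n) (Fin n) F) :
    point z y none = z := rfl

@[simp] theorem point_some {F : Type*} (z : F) (y : Matrix (Fin n) (Fin n) F)
    (p : Fin n × Fin n) : point z y (some p) = y p.1 p.2 := rfl

variable (k : Type u) [Field k]

/-- The polynomial ring in a variable `z` and the entries of an `n × n` matrix. -/
abbrev MatPoly (n : ℕ) := MvPolynomial (Option (Fin n × Fin n)) k

/-- The determinant of the matrix of variables. -/
noncomputable def detPoly (n : ℕ) : MatPoly k n :=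
  (Matrix.of fun a b : Fin n => (MvPolynomial.X (some (a, b)) : MatPoly k n)).det

variable {k}

theorem map_detPoly {S : Type*} [CommRing S] (φ : MatPoly k n →+* S) :
    φ (detPoly k n) = (Matrix.of fun a b => φ (MvPolynomial.X (some (a, b)))).det := by
  rw [detPoly, RingHom.map_det]
  rfl

/-- A polynomial in `z` as a polynomial in `z` and the entries of a matrix. -/
noncomputable def zPoly (n : ℕ) : Polynomial k →ₐ[k] MatPoly k n :=
  Polynomial.aeval (MvPolynomial.X none)

theorem map_zPoly {S : Type*} [CommRing S] [Algebra k S] (φ : MatPoly k n →ₐ[k] S)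
    (q : Polynomial k) :
    φ (zPoly n q) = Polynomial.aeval (φ (MvPolynomial.X none)) q := by
  rw [zPoly, Polynomial.aeval_algHom_apply]

theorem aeval_point_zPoly {F : Type*} [Field F] [Algebra k F] (z : k)
    (y : Matrix (Fin n) (Fin n) F) (q : Polynomial k) :
    MvPolynomial.aeval (point (algebraMap k F z) y) (zPoly n q) = algebraMap k F (q.eval z) := by
  rw [map_zPoly, MvPolynomial.aeval_X, point_none,
    Polynomial.aeval_algebraMap_apply_eq_algebraMap_eval]

/-- Substitution of a shifted point into a polynomial, after clearing denominators. -/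
theorem exists_shift_matPoly (D : Polynomial k) (M : Matrix (Fin n) (Fin n) (Polynomial k))
    (P : MatPoly k n) :
    ∃ (m : ℕ) (P' : MatPoly k n), ∀ (F : Type u) [Field F] [Algebra k F] (z : k)
      (y y' : Matrix (Fin n) (Fin n) F),
      algebraMap k F (D.eval z) • y' = (M.map fun q => algebraMap k F (q.eval z)) * y →
      MvPolynomial.aeval (point (algebraMap k F z) y) P' = algebraMap k F (D.eval z) ^ m *
        MvPolynomial.aeval (point (algebraMap k F (z + 1)) y') P := by
  induction P using MvPolynomial.induction_on with
  | C a => exact ⟨0, MvPolynomial.C a, by intros; simp⟩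
  | add P Q hP hQ =>
    obtain ⟨a, P', hP⟩ := hP
    obtain ⟨b, Q', hQ⟩ := hQ
    refine ⟨a + b, zPoly n D ^ b * P' + zPoly n D ^ a * Q', fun F _ _ z y y' h => ?_⟩
    rw [map_add, map_add, map_mul, map_mul, map_pow, map_pow, aeval_point_zPoly, hP F z y y' h,
      hQ F z y y' h]
    ring
  | mul_X P o hP =>
    obtain ⟨a, P', hP⟩ := hP
    rcases o with _ | ⟨i, j⟩
    · refine ⟨a, P' * (MvPolynomial.X none + 1), fun F _ _ z y y' h => ?_⟩
      rw [map_mul, map_mul, hP F z y y' h]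
      simp
      ring
    -- Each matrix entry costs one more factor `D`, which turns the entry of `y'` into that of `M
    -- y`.
    · refine ⟨a + 1, P' * ∑ l, zPoly n (M i l) * MvPolynomial.X (some (l, j)),
        fun F _ _ z y y' h => ?_⟩
      have hij := congrFun (congrFun h i) j
      simp only [Matrix.smul_apply, smul_eq_mul, Matrix.mul_apply, Matrix.map_apply] at hij
      rw [map_mul, map_mul, hP F z y y' h, map_sum]
      simp only [map_mul, aeval_point_zPoly, MvPolynomial.aeval_X, point_some]
      rw [← hij]
      ring

/-- Right multiplication of the matrix of variables by a matrix. -/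
noncomputable def rightMul (g : Matrix (Fin n) (Fin n) k) : MatPoly k n →ₐ[k] MatPoly k n :=
  MvPolynomial.aeval (point (MvPolynomial.X none)
    ((Matrix.of fun a b : Fin n => (MvPolynomial.X (some (a, b)) : MatPoly k n)) *
      g.map MvPolynomial.C))

theorem aeval_rightMul (g : Matrix (Fin n) (Fin n) k) (z : k) (y : Matrix (Fin n) (Fin n) k)
    (P : MatPoly k n) :
    MvPolynomial.aeval (point z y) (rightMul g P) = MvPolynomial.aeval (point z (y * g)) P := by
  have : (MvPolynomial.aeval (point z y)).comp (rightMul g) =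
      (MvPolynomial.aeval (point z (y * g)) : MatPoly k n →ₐ[k] k) := by
    ext o
    rcases o with _ | ⟨i, j⟩
    · simp [rightMul]
    · simp [rightMul, Matrix.mul_apply]
  exact DFunLike.congr_fun this P

/-- Substitution by `g⁻¹` is a right inverse; over an infinite field this can be checked on values.
-/
theorem rightMul_surjective [Infinite k] (g : Matrix.GeneralLinearGroup (Fin n) k) :
    Function.Surjective (rightMul g.val) := by
  intro P
  refine ⟨rightMul (g⁻¹).val P, MvPolynomial.funext fun x => ?_⟩
  have hx : x = point (x none) (Matrix.of fun a b => x (some (a, b))) := by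
    funext o
    rcases o with _ | ⟨i, j⟩ <;> rfl
  rw [hx]
  change MvPolynomial.aeval _ _ = MvPolynomial.aeval _ _
  rw [aeval_rightMul, aeval_rightMul, mul_assoc, ← Units.val_mul, mul_inv_cancel, Units.val_one,
    mul_one]

/-- Expansion of a polynomial over an extension in a basis of the extension. -/
theorem exists_expansion {F ι τ : Type*} [Field F] [Algebra k F] (b : Module.Basis ι k F)
    (Q : MvPolynomial τ F) :
    ∃ c : ι →₀ MvPolynomial τ k,
      Q = c.sum fun j P => MvPolynomial.C (b j) * MvPolynomial.map (algebraMap k F) P := by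
  induction Q using MvPolynomial.induction_on with
  | C a =>
    refine ⟨(b.repr a).mapRange MvPolynomial.C (map_zero _), ?_⟩
    rw [Finsupp.sum_mapRange_index (by simp)]
    conv_lhs => rw [← b.linearCombination_repr a]
    rw [Finsupp.linearCombination_apply, Finsupp.sum, map_sum]
    refine Finset.sum_congr rfl fun j _ => ?_
    dsimp only
    rw [MvPolynomial.map_C, ← map_mul, Algebra.smul_def, mul_comm]
  | mul_X Q o hQ =>
    obtain ⟨c, hc⟩ := hQ
    refine ⟨c.mapRange (· * MvPolynomial.X o) (zero_mul _), ?_⟩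
    rw [Finsupp.sum_mapRange_index (by simp), hc, Finsupp.sum_mul]
    refine Finset.sum_congr rfl fun j _ => ?_
    simp [mul_assoc]
  | add P Q hP hQ =>
    obtain ⟨c, hc⟩ := hP
    obtain ⟨d, hd⟩ := hQ
    refine ⟨c + d, ?_⟩
    rw [Finsupp.sum_add_index' (by simp) (by simp [mul_add]), ← hc, ← hd]

theorem aeval_expansion {F ι τ : Type*} [Field F] [Algebra k F] (b : ι → F)
    (c : ι →₀ MvPolynomial τ k) (x : τ → F) :
    MvPolynomial.aeval x (c.sum fun j P => MvPolynomial.C (b j) *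
      MvPolynomial.map (algebraMap k F) P) =
      c.sum fun j P => b j * MvPolynomial.aeval x P := by
  rw [Finsupp.sum, map_sum]
  refine Finset.sum_congr rfl fun j _ => ?_
  rw [map_mul, MvPolynomial.aeval_map_algebraMap, ← MvPolynomial.algebraMap_eq, AlgHom.commutes]
  rfl

end Points

/-! ### Maximality of the ideal of relations of a solution -/

section Vanishing

variable {k : Type u} [Field k] {n : ℕ}

/-- An ideal of polynomials in `z` and the entries of a matrix without generic obstruction has
points with algebraic coordinates over all but finitely many values of `z`. -/
theorem exists_point_of_zPoly_notMem (F : Type*) [Field F] [Algebra k F] [IsAlgClosed F]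
    (I : Ideal (MatPoly k n))
    (hI : ∀ (q : Polynomial k) (m : ℕ), zPoly n q * detPoly k n ^ m ∈ I → q = 0) :
    ∃ f : Polynomial k, f ≠ 0 ∧ ∀ a : k, f.eval a ≠ 0 →
      ∃ y : Matrix.GeneralLinearGroup (Fin n) F,
        ∀ P ∈ I, MvPolynomial.aeval (point (algebraMap k F a) y.val) P = 0 := by
  let d := Ideal.Quotient.mk I (detPoly k n)
  -- Inverting the determinant makes the matrix at every point of `B` invertible, and `hI` says
  -- exactly that `z` is transcendental in `B`.
  let B := Localization.Away d
  let ψ : MatPoly k n →ₐ[k] B :=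
    (IsScalarTower.toAlgHom k (MatPoly k n ⧸ I) B).comp (Ideal.Quotient.mkₐ k I)
  have hψ : ∀ P, ψ P = algebraMap (MatPoly k n ⧸ I) B (Ideal.Quotient.mk I P) := fun _ => rfl
  have : Algebra.FiniteType (MatPoly k n ⧸ I) B :=
    IsLocalization.finiteType_of_monoid_fg (Submonoid.powers d) B
  have : Algebra.FiniteType k B :=
    Algebra.FiniteType.trans (S := MatPoly k n ⧸ I) inferInstance this
  have ht : Function.Injective (Polynomial.aeval (R := k) (ψ (MvPolynomial.X none))) := by
    rw [injective_iff_map_eq_zero]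
    intro q hq
    rw [← map_zPoly, hψ, IsLocalization.map_eq_zero_iff (Submonoid.powers d)] at hq
    obtain ⟨⟨_, m, rfl⟩, hm⟩ := hq
    refine hI q m ?_
    rw [← Ideal.Quotient.eq_zero_iff_mem, map_mul, map_pow, mul_comm]
    exact hm
  obtain ⟨f, hf, h⟩ := exists_forall_exists_algHom F _ ht
  refine ⟨f, hf, fun a ha => ?_⟩
  obtain ⟨φ, hφ⟩ := h a ha
  let χ := φ.comp ψ
  have hdet : IsUnit (Matrix.of fun a b => χ (MvPolynomial.X (some (a, b)))).det := by
    have h1 : IsUnit (χ (detPoly k n)) :=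
      (IsLocalization.map_units B (⟨d, Submonoid.mem_powers d⟩ : Submonoid.powers d)).map φ
    have := map_detPoly χ.toRingHom
    change χ (detPoly k n) = _ at this
    rw [this] at h1
    exact h1
  refine ⟨Matrix.GeneralLinearGroup.mk'' _ hdet, fun P hP => ?_⟩
  have hχ : MvPolynomial.aeval (point (algebraMap k F a)
      (Matrix.of fun a b => χ (MvPolynomial.X (some (a, b))))) = χ := by
    ext o
    rcases o with _ | ⟨i, j⟩
    · rw [MvPolynomial.aeval_X, point_none]
      exact hφ.symm
    · simp
  change MvPolynomial.aeval (point (algebraMap k F a)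
      (Matrix.of fun a b => χ (MvPolynomial.X (some (a, b))))) P = 0
  rw [hχ]
  change φ (ψ P) = 0
  rw [hψ, Ideal.Quotient.eq_zero_iff_mem.2 hP, map_zero, map_zero]

/-- The germ at infinity of the values of a polynomial along a sequence of matrices. -/
noncomputable def seqEval (Y : ℕ → Matrix (Fin n) (Fin n) k) : MatPoly k n →+* Seq k :=
  (Germ.coeRingHom atTop).comp (RingHom.pi fun i : ℕ =>
    (MvPolynomial.aeval (point (i : k) (Y i)) : MatPoly k n →ₐ[k] k).toRingHom)

theorem seqEval_apply (Y : ℕ → Matrix (Fin n) (Fin n) k) (P : MatPoly k n) :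
    seqEval Y P = ((fun i : ℕ => MvPolynomial.aeval (point (i : k) (Y i)) P : ℕ → k) : Seq k) :=
  rfl

theorem seqEval_eq_zero (Y : ℕ → Matrix (Fin n) (Fin n) k) (P : MatPoly k n) :
    seqEval Y P = 0 ↔ ∀ᶠ i : ℕ in atTop, MvPolynomial.aeval (point (i : k) (Y i)) P = 0 :=
  Germ.coe_eq

theorem point_map {F : Type*} [Field F] [Algebra k F] (z : k) (y : Matrix (Fin n) (Fin n) k) :
    point (algebraMap k F z) (y.map (algebraMap k F)) = algebraMap k F ∘ point z y := by
  funext o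
  rcases o with _ | ⟨i, j⟩ <;> rfl

variable [CharZero k]

theorem eventually_eval_ne_zero' {p : Polynomial k} (hp : p ≠ 0) :
    ∀ᶠ i : ℕ in atTop, p.eval (i : k) ≠ 0 := by
  filter_upwards [eventually_eval_ne_zero hp] with i hi
  rwa [Polynomial.eval₂_id] at hi

/-- The polynomials vanishing along a solution form a maximal ideal among the ideals that are
stable under the shift and have a generic point. -/
theorem seqEval_eq_zero_of_mem (D : Polynomial k) (hD : D ≠ 0)
    (M : Matrix (Fin n) (Fin n) (Polynomial k)) (Y : ℕ → Matrix.GeneralLinearGroup (Fin n) k)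
    (hY : ∀ᶠ i : ℕ in atTop, D.eval (i : k) • (Y (i + 1)).val =
      (M.map fun q => q.eval (i : k)) * (Y i).val)
    (I : Ideal (MatPoly k n)) (hker : ∀ P, seqEval (fun i => (Y i).val) P = 0 → P ∈ I)
    (hshift : ∀ P ∈ I, ∀ (m : ℕ) (P' : MatPoly k n),
      (∀ᶠ i : ℕ in atTop, MvPolynomial.aeval (point (i : k) (Y i).val) P' = D.eval (i : k) ^ m *
        MvPolynomial.aeval (point ((i : k) + 1) (Y (i + 1)).val) P) → P' ∈ I)
    (hI : ∀ (q : Polynomial k) (m : ℕ), zPoly n q * detPoly k n ^ m ∈ I → q = 0)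
    (P : MatPoly k n) (hP : P ∈ I) : seqEval (fun i => (Y i).val) P = 0 := by
  let F := AlgebraicClosure k
  have : CharZero F := charZero_of_injective_algebraMap (algebraMap k F).injective
  obtain ⟨f, hf, h⟩ := exists_point_of_zPoly_notMem F I hI
  obtain ⟨N, hN⟩ := eventually_atTop.1
    ((hY.and (eventually_eval_ne_zero' hD)).and (eventually_eval_ne_zero' hf))
  obtain ⟨y, hy⟩ := h N (hN N le_rfl).2
  let YF : ℕ → Matrix.GeneralLinearGroup (Fin n) F := fun i =>
    Matrix.GeneralLinearGroup.map (algebraMap k F) (Y i)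
  have hYF : ∀ i, (YF i).val = (Y i).val.map (algebraMap k F) := fun i => rfl
  -- The zero `y` of `I` at `N` becomes the value at `N` of another solution, `YF * g`.
  let g := (YF N)⁻¹ * y
  have hzero : ∀ i, N ≤ i → ∀ P ∈ I,
      MvPolynomial.aeval (point (algebraMap k F (i : k)) ((YF i).val * g.val)) P = 0 := by
    intro i hi
    induction i, hi using Nat.le_induction with
    | base =>
      intro P hP
      rw [← Units.val_mul, mul_inv_cancel_left]
      exact hy P hP
    | succ i hi ih =>
      intro P hP
      -- The same `P'` serves twice: over `k` along `Y` it is seen to lie in `I`, and over `F` along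
      -- `YF * g` it carries the vanishing from `i` to `i + 1`.
      obtain ⟨m, P', hP'⟩ := exists_shift_matPoly D M P
      have hmem : P' ∈ I := by
        refine hshift P hP m P' ?_
        filter_upwards [hY] with i hi
        have := hP' k i _ _ hi
        simpa using this
      have h1 := ih P' hmem
      rw [hP' F i _ ((YF (i + 1)).val * g.val)] at h1
      · have h2 : algebraMap k F (D.eval (i : k)) ≠ 0 := by
          simpa using (hN i hi).1.2
        rw [Nat.cast_succ]
        exact (mul_eq_zero.1 h1).resolve_left (pow_ne_zero _ h2)
      · have h3 := congrArg (fun B => B.map (algebraMap k F)) (hN i hi).1.1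
        rw [← mul_assoc, ← smul_mul_assoc]
        congr 1
        rw [hYF, hYF]
        rw [Matrix.map_mul, Matrix.map_map] at h3
        refine Eq.trans ?_ h3
        ext a b
        simp
  have hF : ∀ P : MatPoly k n, seqEval (fun i => (YF i).val)
      (MvPolynomial.map (algebraMap k F) P) = 0 → seqEval (fun i => (Y i).val) P = 0 := by
    intro P hP
    rw [seqEval_eq_zero] at hP ⊢
    filter_upwards [hP] with i hi
    rw [MvPolynomial.aeval_map_algebraMap, hYF, ← map_natCast (algebraMap k F), point_map,
      MvPolynomial.aeval_algebraMap_apply] at hi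
    exact (map_eq_zero _).1 hi
  apply hF
  have hle : RingHom.ker (seqEval (fun i => (YF i).val)) ≤
      (RingHom.ker (seqEval (fun i => (YF i).val))).comap (rightMul g.val).toRingHom := by
    intro Q hQ
    obtain ⟨c, rfl⟩ := exists_expansion (Module.Basis.ofVectorSpace k F) Q
    -- The values of the `c j` along `Y` lie in `k`, so linear independence of the basis makes each
    -- coefficient a relation of `Y` over `k`.
    have hcI : ∀ j, c j ∈ I := by
      intro j
      apply hker
      rw [RingHom.mem_ker, seqEval_eq_zero] at hQ
      rw [seqEval_eq_zero]
      filter_upwards [hQ] with i hi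
      rw [aeval_expansion, hYF, ← map_natCast (algebraMap k F), point_map] at hi
      by_cases hj : j ∈ c.support
      · refine linearIndependent_iff'.1 (Module.Basis.ofVectorSpace k F).linearIndependent c.support
          (fun j => MvPolynomial.aeval (point (i : k) (Y i).val) (c j)) ?_ j hj
        rw [← hi, Finsupp.sum]
        refine Finset.sum_congr rfl fun j _ => ?_
        rw [MvPolynomial.aeval_algebraMap_apply, Algebra.smul_def, mul_comm]
      · rw [Finsupp.notMem_support_iff.1 hj, map_zero]
    rw [Ideal.mem_comap, RingHom.mem_ker, seqEval_eq_zero]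
    filter_upwards [eventually_ge_atTop N] with i hi
    change MvPolynomial.aeval _ (rightMul g.val _) = 0
    rw [aeval_rightMul, aeval_expansion, Finsupp.sum]
    refine Finset.sum_eq_zero fun j _ => ?_
    rw [← map_natCast (algebraMap k F), hzero i hi _ (hcI j), mul_zero]
  refine comap_le_of_le_comap (rightMul_surjective g) hle ?_
  rw [Ideal.mem_comap, RingHom.mem_ker, seqEval_eq_zero]
  filter_upwards [eventually_ge_atTop N] with i hi
  change MvPolynomial.aeval _ (rightMul g.val _) = 0
  rw [aeval_rightMul, MvPolynomial.aeval_map_algebraMap, ← map_natCast (algebraMap k F)]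
  exact hzero i hi P hP

end Vanishing

/-! ### The algebra generated by a fundamental matrix -/

section GeneratedSubalgebra

variable {K S : Type*} [Field K] [CommRing S] [Algebra K S] {σK : K →+* K} {σ : S →+* S} {n : ℕ}
  {A : Matrix.GeneralLinearGroup (Fin n) K}

/-- The subalgebra `K[Zᵢⱼ, 1 / det Z]`. -/
def generatedSubalgebra (K : Type*) {S : Type*} [Field K] [CommRing S] [Algebra K S] {n : ℕ}
    (Z : Matrix.GeneralLinearGroup (Fin n) S) : Subalgebra K S :=
  Algebra.adjoin K (entries Z ∪ {((Matrix.GeneralLinearGroup.det Z)⁻¹ : Sˣ).val})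

variable {Z : Matrix.GeneralLinearGroup (Fin n) S}

theorem entry_mem_generatedSubalgebra (i j : Fin n) : Z.val i j ∈ generatedSubalgebra K Z :=
  Algebra.subset_adjoin (Or.inl ⟨(i, j), rfl⟩)

theorem det_inv_mem_generatedSubalgebra :
    ((Matrix.GeneralLinearGroup.det Z)⁻¹ : Sˣ).val ∈ generatedSubalgebra K Z :=
  Algebra.subset_adjoin (Or.inr rfl)

theorem IsFundamentalMatrix.map_mem_generatedSubalgebra (hK : IsDifferenceAlgebra σK σ)
    (hZ : IsFundamentalMatrix σ A Z) {x : S} (hx : x ∈ generatedSubalgebra K Z) :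
    σ x ∈ generatedSubalgebra K Z := by
  induction hx using Algebra.adjoin_induction with
  | mem x hx =>
    rcases hx with ⟨⟨i, j⟩, rfl⟩ | rfl
    · simp only
      rw [hZ.apply]
      exact sum_mem fun l _ => mul_mem (Subalgebra.algebraMap_mem _ _)
        (entry_mem_generatedSubalgebra _ _)
    · rw [hZ.map_det_inv]
      exact mul_mem (Subalgebra.algebraMap_mem _ _) det_inv_mem_generatedSubalgebra
  | algebraMap a => rw [hK]; exact Subalgebra.algebraMap_mem _ _
  | add x y _ _ hx hy => rw [map_add]; exact add_mem hx hy
  | mul x y _ _ hx hy => rw [map_mul]; exact mul_mem hx hy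

/-- An invertible matrix as a matrix over the subalgebra that it generates. -/
theorem exists_generatedSubalgebra_matrix (Z : Matrix.GeneralLinearGroup (Fin n) S) :
    ∃ Y : Matrix.GeneralLinearGroup (Fin n) (generatedSubalgebra K Z),
      (∀ i j, (Y.val i j : S) = Z.val i j) ∧
      Algebra.adjoin K (entries Y ∪ {((Matrix.GeneralLinearGroup.det Y)⁻¹ : _ˣ).val}) = ⊤ := by
  let R := generatedSubalgebra K Z
  let W : Matrix (Fin n) (Fin n) R :=
    Matrix.of fun i j => ⟨Z.val i j, entry_mem_generatedSubalgebra i j⟩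
  have hW : R.subtype W.det = (Matrix.GeneralLinearGroup.det Z).val := RingHom.map_det R.subtype W
  let w : R := ⟨_, det_inv_mem_generatedSubalgebra⟩
  have hw : W.det * w = 1 := Subtype.ext (by
    change R.subtype W.det * ((Matrix.GeneralLinearGroup.det Z)⁻¹ : Sˣ).val = 1
    rw [hW, Units.mul_inv])
  let Y : Matrix.GeneralLinearGroup (Fin n) R :=
    Matrix.GeneralLinearGroup.mk'' W (IsUnit.of_mul_eq_one _ hw)
  have hY : ((Matrix.GeneralLinearGroup.det Y)⁻¹ : Rˣ).val = w :=
    Units.inv_eq_of_mul_eq_one_right hw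
  refine ⟨Y, fun i j => rfl, ?_⟩
  have hset : entries Y ∪ {w} = (((↑) : R → S) ⁻¹'
      (entries Z ∪ {((Matrix.GeneralLinearGroup.det Z)⁻¹ : Sˣ).val})) := by
    ext x
    constructor
    · rintro (⟨p, rfl⟩ | rfl)
      · exact Or.inl ⟨p, rfl⟩
      · exact Or.inr rfl
    · rintro (⟨p, hp⟩ | hx)
      · exact Or.inl ⟨p, Subtype.ext hp⟩
      · exact Or.inr (Subtype.ext hx)
  rw [hY, hset]
  exact Algebra.adjoin_adjoin_coe_preimage

theorem IsFundamentalMatrix.isPicardVessiotRing (hK : IsDifferenceAlgebra σK σ)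
    (hZ : IsFundamentalMatrix σ A Z)
    (hR : ∀ x ∈ generatedSubalgebra K Z, σ x ∈ generatedSubalgebra K Z)
    (hs : IsSigmaSimple (σ.restrict (generatedSubalgebra K Z) (generatedSubalgebra K Z) hR)) :
    IsPicardVessiotRing σK (σ.restrict (generatedSubalgebra K Z) (generatedSubalgebra K Z) hR)
      A := by
  obtain ⟨W, hW, hadj⟩ := exists_generatedSubalgebra_matrix (K := K) Z
  refine ⟨fun a => Subtype.ext (hK a), ⟨W, ?_, hadj⟩, hs⟩
  ext i j
  have h := hZ.apply i j
  simp_rw [← hW] at h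
  simp only [Matrix.GeneralLinearGroup.map_apply, Units.val_mul, Matrix.mul_apply]
  rw [AddSubmonoidClass.coe_finsetSum]
  exact h

end GeneratedSubalgebra

/-! ### From relations between solutions to σ-simplicity -/

section PolynomialValues

open Polynomial

variable {k : Type*} [Field k] {n : ℕ} {S : Type*} [CommRing S] [Algebra (RatFunc k) S]
  {Z : Matrix.GeneralLinearGroup (Fin n) S} {f : MatPoly k n →+* S}
  (hz : ∀ q, f (zPoly n q) = algebraMap (RatFunc k) S (algebraMap k[X] (RatFunc k) q))
  (hX : ∀ a b, f (MvPolynomial.X (some (a, b))) = Z.val a b)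

omit [Algebra (RatFunc k) S] in
include hX in
theorem map_detPoly_eq_det : f (detPoly k n) = (Matrix.GeneralLinearGroup.det Z).val := by
  rw [map_detPoly]
  simp_rw [hX]
  rfl

include hz hX in
theorem map_mem_generatedSubalgebra (P : MatPoly k n) :
    f P ∈ generatedSubalgebra (RatFunc k) Z := by
  have hz' : ∀ q : k[X], f (zPoly n q) ∈ generatedSubalgebra (RatFunc k) Z := fun q => by
    rw [hz]
    exact Subalgebra.algebraMap_mem _ _
  induction P using MvPolynomial.induction_on with
  | C a =>
    have := hz' (C a)
    rwa [zPoly, aeval_C] at this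
  | add P Q hP hQ => rw [map_add]; exact add_mem hP hQ
  | mul_X P o hP =>
    rw [map_mul]
    refine mul_mem hP ?_
    rcases o with _ | ⟨a, b⟩
    · have := hz' X
      rwa [zPoly, aeval_X] at this
    · rw [hX]
      exact entry_mem_generatedSubalgebra a b

include hz hX in
/-- Every element of `K[Z, 1 / det Z]` is a polynomial up to a power of the determinant and a
denominator in `k[z]`. -/
theorem exists_mul_eq_map {x : S} (hx : x ∈ generatedSubalgebra (RatFunc k) Z) :
    ∃ (q : k[X]) (m : ℕ) (P : MatPoly k n), q ≠ 0 ∧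
      f (zPoly n q * detPoly k n ^ m) * x = f P := by
  induction hx using Algebra.adjoin_induction with
  | mem x hx =>
    rcases hx with ⟨⟨a, b⟩, rfl⟩ | rfl
    · exact ⟨1, 0, MvPolynomial.X (some (a, b)), one_ne_zero, by simp [hX]⟩
    · refine ⟨1, 1, 1, one_ne_zero, ?_⟩
      rw [map_one, one_mul, pow_one, map_one, map_detPoly_eq_det hX, Units.mul_inv]
  | algebraMap a =>
    refine ⟨a.denom, 0, zPoly n a.num, a.denom_ne_zero, ?_⟩
    rw [pow_zero, mul_one, hz, hz, ← map_mul]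
    congr 1
    have h0 : algebraMap k[X] (RatFunc k) a.denom ≠ 0 := by
      rw [Ne, FaithfulSMul.algebraMap_eq_zero_iff]
      exact a.denom_ne_zero
    rw [mul_comm, ← eq_div_iff h0, RatFunc.num_div_denom]
  | add x y _ _ hx hy =>
    obtain ⟨q, m, P, hq, hx⟩ := hx
    obtain ⟨r, l, Q, hr, hy⟩ := hy
    refine ⟨q * r, m + l, zPoly n r * detPoly k n ^ l * P + zPoly n q * detPoly k n ^ m * Q,
      mul_ne_zero hq hr, ?_⟩
    rw [map_add, map_mul _ _ P, map_mul _ _ Q, ← hx, ← hy]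
    simp only [map_mul, map_pow]
    ring
  | mul x y _ _ hx hy =>
    obtain ⟨q, m, P, hq, hx⟩ := hx
    obtain ⟨r, l, Q, hr, hy⟩ := hy
    refine ⟨q * r, m + l, P * Q, mul_ne_zero hq hr, ?_⟩
    rw [map_mul _ P Q, ← hx, ← hy]
    simp only [map_mul, map_pow]
    ring

include hz hX in
/-- `σ`-simplicity of `K[Z, 1 / det Z]` from a maximality property of the relations of `Z`. -/
theorem isSigmaSimple_restrict [Nontrivial S] {σ : S →+* S} (D : k[X])
    (hmax : ∀ I : Ideal (MatPoly k n), (∀ P, f P = 0 → P ∈ I) →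
      (∀ P ∈ I, ∀ (m : ℕ) (P' : MatPoly k n), f P' = f (zPoly n D) ^ m * σ (f P) → P' ∈ I) →
      (∀ (q : k[X]) (m : ℕ), zPoly n q * detPoly k n ^ m ∈ I → q = 0) → ∀ P ∈ I, f P = 0)
    (hR : ∀ x ∈ generatedSubalgebra (RatFunc k) Z, σ x ∈ generatedSubalgebra (RatFunc k) Z) :
    IsSigmaSimple (σ.restrict (generatedSubalgebra (RatFunc k) Z)
      (generatedSubalgebra (RatFunc k) Z) hR) := by
  refine ⟨inferInstance, fun J hJ => ?_⟩
  let R := generatedSubalgebra (RatFunc k) Z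
  let g : MatPoly k n →+* R := f.codRestrict R (map_mem_generatedSubalgebra hz hX)
  have hunit : ∀ (q : k[X]) (m : ℕ), q ≠ 0 → IsUnit (g (zPoly n q * detPoly k n ^ m)) := by
    intro q m hq
    rw [map_mul, map_pow]
    refine IsUnit.mul ?_ (IsUnit.pow _ ?_)
    · have : g (zPoly n q) = algebraMap (RatFunc k) R (algebraMap k[X] (RatFunc k) q) :=
        Subtype.ext (hz q)
      rw [this]
      refine IsUnit.map _ (IsUnit.mk0 _ ?_)
      rwa [Ne, FaithfulSMul.algebraMap_eq_zero_iff]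
    · refine IsUnit.of_mul_eq_one ⟨_, det_inv_mem_generatedSubalgebra⟩ (Subtype.ext ?_)
      change f (detPoly k n) * ((Matrix.GeneralLinearGroup.det Z)⁻¹ : Sˣ).val = 1
      rw [map_detPoly_eq_det hX, Units.mul_inv]
  by_cases htop : J = ⊤
  · exact Or.inr htop
  left
  -- A polynomial `q(z)·det^m` with `q ≠ 0` maps to a unit, so the pullback of the proper ideal `J`
  -- contains none; maximality then makes it the ideal of relations.
  have key := hmax (J.comap g)
    (fun P hP => by
      have : g P = 0 := Subtype.ext hP
      rw [Ideal.mem_comap, this]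
      exact zero_mem _)
    (fun P hP m P' h => by
      have : g P' = g (zPoly n D) ^ m * (σ.restrict R R hR) (g P) := Subtype.ext h
      rw [Ideal.mem_comap, this]
      exact Ideal.mul_mem_left _ _ (hJ _ hP))
    (fun q m h => by
      by_contra hq
      exact htop (Ideal.eq_top_of_isUnit_mem _ h (hunit q m hq)))
  rw [eq_bot_iff]
  intro x hx
  obtain ⟨q, m, P, hq, h⟩ := exists_mul_eq_map hz hX x.2
  have hgx : g (zPoly n q * detPoly k n ^ m) * x = g P := Subtype.ext h
  have hP : P ∈ J.comap g := by
    rw [Ideal.mem_comap, ← hgx]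
    exact Ideal.mul_mem_left _ _ hx
  have : g P = 0 := Subtype.ext (key P hP)
  rw [this] at hgx
  exact ((hunit q m hq).mul_right_eq_zero).1 hgx

end PolynomialValues

/-! ### The shift on k(z) and on sequences -/

section Sequences

open Polynomial

variable {k : Type u} [Field k]

theorem ratShift_algebraMap (p : k[X]) :
    ratShift k (algebraMap k[X] (RatFunc k) p) = algebraMap k[X] (RatFunc k) (taylor 1 p) := by
  rw [ratShift, RatFunc.coe_mapRingHom_eq_coe_map]
  simpa using RatFunc.map_apply_div (taylorAlgHom (1 : k)) _ p 1

theorem ratShift_surjective : Function.Surjective (ratShift k) := by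
  intro a
  refine ⟨algebraMap _ _ (taylor (-1) a.num) / algebraMap _ _ (taylor (-1) a.denom), ?_⟩
  rw [map_div₀, ratShift_algebraMap, ratShift_algebraMap, taylor_taylor, taylor_taylor]
  simp [RatFunc.num_div_denom]

theorem seqShift_coe (f : ℕ → k) : seqShift k (f : Seq k) = ((fun i => f (i + 1) : ℕ → k) : Seq k) :=
  rfl

/-- The constant sequences are the only constants. -/
theorem exists_eq_const_of_seqShift_eq {x : Seq k} (hx : seqShift k x = x) :
    ∃ a : k, x = ((fun _ => a : ℕ → k) : Seq k) := by
  induction x using Germ.inductionOn with | _ f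
  rw [seqShift_coe, Germ.coe_eq] at hx
  obtain ⟨N, hN⟩ := eventually_atTop.1 hx
  refine ⟨f N, Germ.coe_eq.2 ?_⟩
  filter_upwards [eventually_ge_atTop N] with i hi
  induction i, hi using Nat.le_induction with
  | base => rfl
  | succ i hi ih => rw [← ih]; exact hN i hi

variable [CharZero k]

theorem algebraMap_seq_polynomial (p : k[X]) :
    algebraMap (RatFunc k) (Seq k) (algebraMap k[X] (RatFunc k) p) =
      ((fun i : ℕ => p.eval (i : k) : ℕ → k) : Seq k) := by
  refine Germ.coe_eq.2 (Eventually.of_forall fun i => ?_)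
  simp [RatFunc.eval_algebraMap]

theorem isDifferenceAlgebra_seq : IsDifferenceAlgebra (ratShift k) (seqShift k) := by
  intro a
  have : (seqShift k).comp (algebraMap (RatFunc k) (Seq k)) =
      (algebraMap (RatFunc k) (Seq k)).comp (ratShift k) := by
    refine IsLocalization.ringHom_ext (nonZeroDivisors k[X]) (RingHom.ext fun p => ?_)
    simp only [RingHom.comp_apply]
    rw [ratShift_algebraMap, algebraMap_seq_polynomial, algebraMap_seq_polynomial, seqShift_coe]
    simp [taylor_eval]
  exact DFunLike.congr_fun this a

/-- A shift-invariant germ is a constant sequence, which is the image of a constant polynomial; the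
constants of k(z) need not be computed. -/
theorem constants_restrict_seqShift (R : Subalgebra (RatFunc k) (Seq k))
    (hR : ∀ x ∈ R, seqShift k x ∈ R) :
    constants ((seqShift k).restrict R R hR) =
      (constants (ratShift k)).map (algebraMap (RatFunc k) R) := by
  ext x
  constructor
  · intro hx
    have hx : seqShift k (x : Seq k) = x := congrArg Subtype.val hx
    obtain ⟨a, ha⟩ := exists_eq_const_of_seqShift_eq hx
    refine ⟨algebraMap k[X] (RatFunc k) (C a), ?_, Subtype.ext ?_⟩
    · show ratShift k _ = _
      rw [ratShift_algebraMap, taylor_C]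
      rfl
    · rw [ha]
      refine (algebraMap_seq_polynomial (C a)).trans ?_
      simp
  · rintro ⟨a, ha, rfl⟩
    have ha : ratShift k a = a := ha
    refine Subtype.ext ?_
    exact (isDifferenceAlgebra_seq a).trans (by rw [ha]; rfl)

end Sequences

/-! ### Fundamental matrices of sequences -/

section Solutions

open Polynomial

variable {k : Type u} [Field k] {n : ℕ}

/-- A sequence of invertible matrices as an invertible matrix of sequences. -/
noncomputable def seqMatrix (Y : ℕ → Matrix.GeneralLinearGroup (Fin n) k) :
    Matrix.GeneralLinearGroup (Fin n) (Seq k) :=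
  Matrix.GeneralLinearGroup.map (Germ.coeRingHom atTop)
    { val := Matrix.of fun a b i => (Y i).val a b
      inv := Matrix.of fun a b i => (Y i)⁻¹.val a b
      val_inv := by
        ext a b i
        have := congrFun (congrFun (Units.mul_inv (Y i)) a) b
        rw [Matrix.mul_apply] at this
        simp only [Matrix.mul_apply, Finset.sum_apply, Pi.mul_apply, Matrix.of_apply]
        rw [this, Matrix.one_apply, Matrix.one_apply]
        split_ifs <;> rfl
      inv_val := by
        ext a b i
        have := congrFun (congrFun (Units.inv_mul (Y i)) a) b
        rw [Matrix.mul_apply] at this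
        simp only [Matrix.mul_apply, Finset.sum_apply, Pi.mul_apply, Matrix.of_apply]
        rw [this, Matrix.one_apply, Matrix.one_apply]
        split_ifs <;> rfl }

theorem seqMatrix_apply (Y : ℕ → Matrix.GeneralLinearGroup (Fin n) k) (a b : Fin n) :
    (seqMatrix Y).val a b = ((fun i => (Y i).val a b : ℕ → k) : Seq k) :=
  rfl

theorem sum_coe_seq {ι : Type*} (s : Finset ι) (f : ι → ℕ → k) :
    ∑ l ∈ s, ((f l : ℕ → k) : Seq k) = ((fun i => ∑ l ∈ s, f l i : ℕ → k) : Seq k) := by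
  have := map_sum (Germ.coeRingHom (R := k) (atTop : Filter ℕ)) f s
  refine this.symm.trans (congrArg _ ?_)
  ext i
  simp

/-- A matrix of rational functions has a common denominator. -/
theorem exists_common_denominator (A : Matrix (Fin n) (Fin n) (RatFunc k)) :
    ∃ (D : k[X]) (M : Matrix (Fin n) (Fin n) k[X]), D ≠ 0 ∧
      ∀ i j, algebraMap k[X] (RatFunc k) D * A i j = algebraMap k[X] (RatFunc k) (M i j) := by
  obtain ⟨D, hD⟩ := IsLocalization.exist_integer_multiples_of_finite (nonZeroDivisors k[X])
    (fun p : Fin n × Fin n => A p.1 p.2)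
  choose M hM using hD
  refine ⟨D, Matrix.of fun i j => M (i, j), nonZeroDivisors.ne_zero D.2, fun i j => ?_⟩
  rw [Matrix.of_apply, hM, Algebra.smul_def]

theorem seqEval_X_some (Y : ℕ → Matrix.GeneralLinearGroup (Fin n) k) (a b : Fin n) :
    seqEval (fun i => (Y i).val) (MvPolynomial.X (some (a, b))) = (seqMatrix Y).val a b := by
  rw [seqEval_apply, seqMatrix_apply]
  simp

variable [CharZero k]

/-- A linear difference equation with polynomial coefficients has an invertible matrix of
solutions at large arguments. -/
theorem exists_sequence_of_solutions (D : k[X]) (hD : D ≠ 0) (M : Matrix (Fin n) (Fin n) k[X])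
    (hM : M.det ≠ 0) :
    ∃ Y : ℕ → Matrix.GeneralLinearGroup (Fin n) k, ∀ᶠ i : ℕ in atTop,
      D.eval (i : k) • (Y (i + 1)).val = (M.map fun q => q.eval (i : k)) * (Y i).val := by
  have hB : ∀ i : ℕ, ∃ B : Matrix.GeneralLinearGroup (Fin n) k,
      D.eval (i : k) ≠ 0 → M.det.eval (i : k) ≠ 0 →
        D.eval (i : k) • B.val = M.map fun q => q.eval (i : k) := by
    intro i
    by_cases h : D.eval (i : k) ≠ 0 ∧ M.det.eval (i : k) ≠ 0
    · have hdet : IsUnit ((D.eval (i : k))⁻¹ • M.map fun q => q.eval (i : k)).det := by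
        rw [Matrix.det_smul]
        have : (M.map fun q => q.eval (i : k)).det = M.det.eval (i : k) :=
          (RingHom.map_det (evalRingHom (i : k)) M).symm
        rw [this]
        exact (mul_ne_zero (pow_ne_zero _ (inv_ne_zero h.1)) h.2).isUnit
      refine ⟨Matrix.GeneralLinearGroup.mk'' _ hdet, fun _ _ => ?_⟩
      exact smul_inv_smul₀ h.1 _
    -- At the finitely many zeros of `D` or `det M` the identity is a harmless default that keeps
    -- every `Y i` invertible.
    · exact ⟨1, fun h1 h2 => absurd ⟨h1, h2⟩ h⟩
  choose B hB using hB
  refine ⟨fun i => Nat.rec 1 (fun i y => B i * y) i, ?_⟩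
  filter_upwards [eventually_eval_ne_zero' hD, eventually_eval_ne_zero' hM] with i h1 h2
  rw [← hB i h1 h2, smul_mul_assoc]
  rfl

theorem isFundamentalMatrix_seqMatrix {A : Matrix.GeneralLinearGroup (Fin n) (RatFunc k)}
    {D : k[X]} (hD : D ≠ 0) {M : Matrix (Fin n) (Fin n) k[X]}
    (hM : ∀ i j, algebraMap k[X] (RatFunc k) D * A.val i j =
      algebraMap k[X] (RatFunc k) (M i j))
    {Y : ℕ → Matrix.GeneralLinearGroup (Fin n) k}
    (hY : ∀ᶠ i : ℕ in atTop, D.eval (i : k) • (Y (i + 1)).val =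
      (M.map fun q => q.eval (i : k)) * (Y i).val) :
    IsFundamentalMatrix (seqShift k) A (seqMatrix Y) := by
  have hDu : IsUnit (algebraMap (RatFunc k) (Seq k) (algebraMap k[X] (RatFunc k) D)) := by
    refine IsUnit.map _ (IsUnit.mk0 _ ?_)
    rwa [Ne, FaithfulSMul.algebraMap_eq_zero_iff]
  ext a b
  simp only [Matrix.GeneralLinearGroup.map_apply, Units.val_mul, Matrix.mul_apply]
  apply hDu.mul_left_cancel
  rw [Finset.mul_sum]
  simp_rw [← mul_assoc, ← map_mul, hM, algebraMap_seq_polynomial, seqMatrix_apply, seqShift_coe,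
    ← Germ.coe_mul]
  rw [sum_coe_seq]
  refine Germ.coe_eq.2 ?_
  filter_upwards [hY] with i hi
  have := congrFun (congrFun hi a) b
  simpa [Matrix.mul_apply] using this

theorem seqEval_zPoly (Y : ℕ → Matrix (Fin n) (Fin n) k) (q : k[X]) :
    seqEval Y (zPoly n q) =
      algebraMap (RatFunc k) (Seq k) (algebraMap k[X] (RatFunc k) q) := by
  rw [algebraMap_seq_polynomial, seqEval_apply]
  refine congrArg _ (funext fun i => ?_)
  exact aeval_point_zPoly (F := k) (i : k) (Y i) q

/-- The ring generated over `k(z)` by the entries and the inverse determinant of a fundamental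
matrix of sequences is `σ`-simple. -/
theorem isSigmaSimple_generatedSubalgebra {D : k[X]} (hD : D ≠ 0)
    {M : Matrix (Fin n) (Fin n) k[X]} {Y : ℕ → Matrix.GeneralLinearGroup (Fin n) k}
    (hY : ∀ᶠ i : ℕ in atTop, D.eval (i : k) • (Y (i + 1)).val =
      (M.map fun q => q.eval (i : k)) * (Y i).val)
    (hR : ∀ x ∈ generatedSubalgebra (S := Seq k) (RatFunc k) (seqMatrix Y),
      seqShift k x ∈ generatedSubalgebra (S := Seq k) (RatFunc k) (seqMatrix Y)) :
    IsSigmaSimple ((seqShift k).restrict (generatedSubalgebra (S := Seq k) (RatFunc k) (seqMatrix Y))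
      (generatedSubalgebra (S := Seq k) (RatFunc k) (seqMatrix Y)) hR) := by
  have : Nontrivial (Seq k) := inferInstance
  refine isSigmaSimple_restrict (seqEval_zPoly fun i => (Y i).val) (seqEval_X_some Y) D
    (fun I hker hshift hI => ?_) hR
  refine seqEval_eq_zero_of_mem D hD M Y hY I hker (fun P hP m P' h => hshift P hP m P' ?_) hI
  rw [seqEval_zPoly, algebraMap_seq_polynomial, seqEval_apply, seqEval_apply, seqShift_coe,
    ← Germ.coe_pow, ← Germ.coe_mul]
  refine Germ.coe_eq.2 ?_
  filter_upwards [h] with i hi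
  simpa using hi

end Solutions

end PicardVessiot

theorem mainTheorem5 (k : Type u) [Field k] [CharZero k] (n : ℕ)
    (A : Matrix.GeneralLinearGroup (Fin n) (RatFunc k)) :
    (∃ (R : Subalgebra (RatFunc k) (PicardVessiot.Seq k))
        (hR : ∀ x ∈ R, PicardVessiot.seqShift k x ∈ R),
      PicardVessiot.IsPicardVessiotRing (PicardVessiot.ratShift k)
        ((PicardVessiot.seqShift k).restrict R R hR) A) ∧
    (∃ (L : Type u) (_ : CommRing L) (_ : Algebra (RatFunc k) L) (σ : L →+* L),
      PicardVessiot.IsPicardVessiotExtension (PicardVessiot.ratShift k) σ A) := by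
  open PicardVessiot in
  obtain ⟨D, M, hD, hM⟩ := exists_common_denominator A.val
  -- From M = D·A one gets det M = Dⁿ·det A in k(z).
  have hdet : M.det ≠ 0 := by
    have h1 : (algebraMap (Polynomial k) (RatFunc k)).mapMatrix M =
        algebraMap (Polynomial k) (RatFunc k) D • A.val := by
      ext i j
      exact (hM i j).symm
    have h2 := congrArg Matrix.det h1
    rw [← RingHom.map_det, Matrix.det_smul] at h2
    intro h
    rw [h, map_zero] at h2
    refine mul_ne_zero (pow_ne_zero _ ?_) (Matrix.GeneralLinearGroup.det A).ne_zero h2.symm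
    rwa [Ne, FaithfulSMul.algebraMap_eq_zero_iff]
  obtain ⟨Y, hY⟩ := exists_sequence_of_solutions D hD M hdet
  have hZ := isFundamentalMatrix_seqMatrix hD hM hY
  have hR : ∀ x ∈ generatedSubalgebra (S := Seq k) (RatFunc k) (seqMatrix Y),
      seqShift k x ∈ generatedSubalgebra (S := Seq k) (RatFunc k) (seqMatrix Y) :=
    fun x hx => hZ.map_mem_generatedSubalgebra isDifferenceAlgebra_seq hx
  have hPV := hZ.isPicardVessiotRing isDifferenceAlgebra_seq hR
    (isSigmaSimple_generatedSubalgebra hD hY hR)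
  exact ⟨⟨_, hR, hPV⟩, _, _, _, _, hPV.fractionRing
    ⟨hPV.simple.injective, hPV.surjective ratShift_surjective⟩ (constants_restrict_seqShift _ hR)⟩
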